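/- **Notation.** Let $d\in\mathbb N$ and let $\Omega\subset\mathbb R^d$ be open. Distributions and test functions take values in $\mathbb K=\mathbb R$ or $\mathbb K=\mathbb C$. $\mathscr D(\Omega)$ is the space of test functions on $\Omega$ with its usual (LF) topology, and $\mathscr D'(\Omega)$ is its dual with the strong topology. For $x,y\in\mathbb R^d$ put $xy=(x_1y_1,\dots,x_dy_d)$, let $\mathbb R_*^d=(\mathbb R\setminus\{0\})^d$, and for $M\subset\mathbb R_*^d$ let $1/M=\{(1/y_1,\dots,1/y_d): y\in M\}$. Let $\tilde\Omega=\bigcup_{a\in\mathbb R_*^d}a\Omega$; this is an open set that contains $\Omega$ and is invariant under the dilations $x\mapsto xy$, $y\in\mathbb R_*^d$. A *Hadamard operator* on $\mathscr D'(\Omega)$ is a continuous linear map $L:\mathscr D'(\Omega)\to\mathscr D'(\Omega)$ which admits all monomials as eigenvectors, i.e. for every $\alpha\in\mathbb N_0^d$ there is $m_\alpha\in\mathbb K$ with $L(\xi^\alpha)=m_\alpha\,\xi^\alpha$, where $\xi^\alpha$ is regarded as the distribution $\varphi\mapsto\int\xi^\alpha\varphi(\xi)\,d\xi$ on $\Omega$.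 For $T\in\mathscr D'(\tilde\Omega)$ and $\varphi\in\mathscr D(\tilde\Omega)$ consider the function $y\mapsto T_x\varphi(xy)$, defined for $y\in\mathbb R_*^d$ (then $\varphi(\cdot\,y)\in\mathscr D(\tilde\Omega)$). We say that it belongs to $\mathscr D(\tilde\Omega)$ (or to $\mathscr D(\Omega)$) if it is the restriction to $\mathbb R_*^d$ of a function $\psi$ in that space; this $\psi$ is unique because $\mathbb R_*^d$ is dense in $\mathbb R^d$, and it is again denoted by $T_x\varphi(x\,\cdot)$. Let $\mathscr D'_H(\Omega)$ be the set of all $T\in\mathscr D'(\tilde\Omega)$ such that 1. $T_x\varphi(x\,\cdot)\in\mathscr D(\tilde\Omega)$ for all $\varphi\in\mathscr D(\tilde\Omega)$; 2. $\operatorname{supp}T\subset\mathbb R_*^d$, and for every compact $K\subset\Omega$ the set $(1/\operatorname{supp}T)\,K=\{(1/x)k: x\in\operatorname{supp}T,\ k\in K\}$ is relatively compact in $\Omega$, i.e. contained in a compact subset of $\Omega$. **Theorem.** For every Hadamard operator $L$ on $\mathscr D'(\Omega)$ there is $T\in\mathscr D'_H(\Omega)$ such that $L(S)=S\star T$ for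 all $S\in\mathscr D'(\Omega)$. That is, for every $\varphi\in\mathscr D(\Omega)$ the function $T_x\varphi(x\,\cdot)$ belongs to $\mathscr D(\Omega)$, and $$(L(S))(\varphi)=S_y\big(T_x\varphi(xy)\big)\qquad\text{for all }S\in\mathscr D'(\Omega),\ \varphi\in\mathscr D(\Omega).$$ -/

import Mathlib

open TopologicalSpace MeasureTheory
open scoped Distributions Pointwise

namespace HadamardOp

/-- The space `𝓓'(Ω)` of (real or complex) distributions on an open set `Ω ⊆ ℝ^d`: the continuous
linear functionals on the LF-space of test functions, with the strong dual topology (uniform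
convergence on bounded sets), which is Mathlib's topology on `→L`. The space `Fin d → ℝ` carries
the coordinatewise product `x * y`, with unit `1`. -/
abbrev DPrime (𝕜 : Type*) [RCLike 𝕜] {d : ℕ} (Ω : Opens (Fin d → ℝ)) : Type _ :=
  𝓓(Ω, 𝕜) →L[𝕜] 𝕜

/-- The monomial `ξ ↦ ξ^α`, as a scalar valued function on `ℝ^d`. -/
def monomialFun (𝕜 : Type*) [RCLike 𝕜] {d : ℕ} (α : Fin d → ℕ) (x : Fin d → ℝ) : 𝕜 :=
  ∏ i, ((x i : ℝ) : 𝕜) ^ α i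

theorem continuous_monomialFun (𝕜 : Type*) [RCLike 𝕜] {d : ℕ} (α : Fin d → ℕ) :
    Continuous (monomialFun 𝕜 α) := by
  unfold monomialFun
  exact continuous_finsetProd _ fun i _ =>
    (RCLike.continuous_ofReal.comp (continuous_apply i)).pow _

/-- The monomial `ξ^α` as a (regular) distribution on `Ω`, that is `φ ↦ ∫ φ(ξ) ξ^α dξ`. -/
noncomputable def monomial (𝕜 : Type*) [RCLike 𝕜] {d : ℕ} (Ω : Opens (Fin d → ℝ))
    (α : Fin d → ℕ) : DPrime 𝕜 Ω :=
  TestFunction.integralAgainstBilinCLM (ContinuousLinearMap.mul 𝕜 𝕜) volume (monomialFun 𝕜 α)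

theorem monomial_apply (𝕜 : Type*) [RCLike 𝕜] {d : ℕ} (Ω : Opens (Fin d → ℝ))
    (α : Fin d → ℕ) (φ : 𝓓(Ω, 𝕜)) :
    monomial 𝕜 Ω α φ = ∫ x, φ x * monomialFun 𝕜 α x := by
  have h : LocallyIntegrableOn (monomialFun 𝕜 α) (Ω : Set (Fin d → ℝ)) volume :=
    (continuous_monomialFun 𝕜 α).locallyIntegrable.locallyIntegrableOn _
  exact TestFunction.integralAgainstBilinCLM_eq_integral h

/-- A Hadamard operator: a continuous linear operator on `𝓓'(Ω)` for which every monomial is an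
eigenvector. (If `Ω` is nonempty, the monomials are nonzero elements of `𝓓'(Ω)`.) -/
def IsHadamard {𝕜 : Type*} [RCLike 𝕜] {d : ℕ} {Ω : Opens (Fin d → ℝ)}
    (L : DPrime 𝕜 Ω →L[𝕜] DPrime 𝕜 Ω) : Prop :=
  ∀ α : Fin d → ℕ, ∃ m : 𝕜, L (monomial 𝕜 Ω α) = m • monomial 𝕜 Ω α

/-- `ℝ_*^d = (ℝ \ {0})^d`. -/
def RStar (d : ℕ) : Set (Fin d → ℝ) := {a | ∀ i, a i ≠ 0}

theorem inv_mul_cancel_of_mem {d : ℕ} {a : Fin d → ℝ} (ha : a ∈ RStar d) (x : Fin d → ℝ) :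
    a⁻¹ * (a * x) = x := by
  funext i
  simp [inv_mul_cancel_left₀ (ha i)]

theorem mul_inv_cancel_of_mem {d : ℕ} {a : Fin d → ℝ} (ha : a ∈ RStar d) (x : Fin d → ℝ) :
    a * (a⁻¹ * x) = x := by
  funext i
  simp [mul_inv_cancel_left₀ (ha i)]

theorem inv_mem {d : ℕ} {a : Fin d → ℝ} (ha : a ∈ RStar d) : a⁻¹ ∈ RStar d :=
  fun i => inv_ne_zero (ha i)

theorem mul_mem {d : ℕ} {a b : Fin d → ℝ} (ha : a ∈ RStar d) (hb : b ∈ RStar d) :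
    a * b ∈ RStar d :=
  fun i => mul_ne_zero (ha i) (hb i)

/-- The invertible dilation `x ↦ x * a` as a homeomorphism of `ℝ^d`. -/
noncomputable def dilation {d : ℕ} (a : Fin d → ℝ) (ha : a ∈ RStar d) : (Fin d → ℝ) ≃ₜ (Fin d → ℝ) where
  toFun x := x * a
  invFun x := x * a⁻¹
  left_inv x := by
    change x * a * a⁻¹ = x
    rw [mul_comm, mul_comm x a]; exact inv_mul_cancel_of_mem ha x
  right_inv x := by
    change x * a⁻¹ * a = x
    rw [mul_comm, mul_comm x a⁻¹]; exact mul_inv_cancel_of_mem ha x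
  continuous_toFun := by fun_prop
  continuous_invFun := by fun_prop

/-- `Ω̃ = ⋃_{a ∈ ℝ_*^d} a Ω`. -/
def dilationHull {d : ℕ} (Ω : Opens (Fin d → ℝ)) : Opens (Fin d → ℝ) where
  carrier := ⋃ a ∈ RStar d, (fun x => a * x) '' (Ω : Set (Fin d → ℝ))
  is_open' := by
    refine isOpen_biUnion fun a ha => ?_
    have h := (dilation a ha).isOpenMap _ Ω.isOpen
    have e : (fun x => a * x) = ⇑(dilation a ha) := by
      funext x; exact mul_comm a x
    rw [e]; exact h

theorem mem_dilationHull {d : ℕ} {Ω : Opens (Fin d → ℝ)} {x : Fin d → ℝ} :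
    x ∈ dilationHull Ω ↔ ∃ a ∈ RStar d, ∃ w ∈ Ω, a * w = x := by
  change x ∈ (⋃ a ∈ RStar d, (fun x => a * x) '' (Ω : Set (Fin d → ℝ))) ↔ _
  simp

theorem le_dilationHull {d : ℕ} (Ω : Opens (Fin d → ℝ)) : Ω ≤ dilationHull Ω := fun x hx =>
  mem_dilationHull.2 ⟨1, fun _ => one_ne_zero, x, hx, one_mul x⟩

/-- A test function on `Ω` regarded as a test function on `Ω̃`. -/
noncomputable def incl {𝕜 : Type*} [RCLike 𝕜] {d : ℕ} {Ω : Opens (Fin d → ℝ)} (φ : 𝓓(Ω, 𝕜)) :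
    𝓓(dilationHull Ω, 𝕜) where
  toFun := φ
  contDiff' := φ.contDiff
  hasCompactSupport' := φ.hasCompactSupport
  tsupport_subset' := φ.tsupport_subset.trans (le_dilationHull Ω)

/-- The test function `x ↦ φ (x y)` on `Ω̃`, for `φ ∈ 𝓓(Ω̃)` and `y ∈ ℝ_*^d`. -/
noncomputable def dilate {𝕜 : Type*} [RCLike 𝕜] {d : ℕ} {Ω : Opens (Fin d → ℝ)}
    (φ : 𝓓(dilationHull Ω, 𝕜)) (y : Fin d → ℝ) (hy : y ∈ RStar d) :
    𝓓(dilationHull Ω, 𝕜) where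
  toFun x := φ (x * y)
  contDiff' := φ.contDiff.comp (contDiff_id.mul contDiff_const)
  hasCompactSupport' := φ.hasCompactSupport.comp_homeomorph (dilation y hy)
  tsupport_subset' := by
    intro x hx
    have hx' : x * y ∈ tsupport φ :=
      tsupport_comp_subset_preimage φ (dilation y hy).continuous hx
    obtain ⟨a, ha, w, hw, e⟩ := mem_dilationHull.1 (φ.tsupport_subset hx')
    refine mem_dilationHull.2 ⟨y⁻¹ * a, mul_mem (inv_mem hy) ha, w, hw, ?_⟩
    rw [mul_assoc, e, mul_comm x y]
    exact inv_mul_cancel_of_mem hy x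

/-- `f` is the function `y ↦ T_x φ(x y)`. For `T ∈ 𝓓'(Ω̃)` and `φ ∈ 𝓓(Ω̃)` the right-hand side is
defined for `y ∈ ℝ_*^d`; as `ℝ_*^d` is dense, a continuous `f` is determined by this. -/
def IsTransform {𝕜 : Type*} [RCLike 𝕜] {d : ℕ} {Ω : Opens (Fin d → ℝ)}
    (T : DPrime 𝕜 (dilationHull Ω)) (φ : 𝓓(dilationHull Ω, 𝕜)) (f : (Fin d → ℝ) → 𝕜) : Prop :=
  ∀ (y : Fin d → ℝ) (hy : y ∈ RStar d), f y = T (dilate φ y hy)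

/-- The support of `T ∈ 𝓓'(U)`, a relatively closed subset of `U`. (`Distribution.dsupport` is the
closure of this set in `ℝ^d`.) -/
def supp {𝕜 : Type*} [RCLike 𝕜] {d : ℕ} {U : Opens (Fin d → ℝ)} (T : DPrime 𝕜 U) :
    Set (Fin d → ℝ) :=
  Distribution.dsupport T ∩ U

/-- The space `𝓓'_H(Ω)` of all `T ∈ 𝓓'(Ω̃)` such that `y ↦ T_x φ(x y)` is in `𝓓(Ω̃)` for all
`φ ∈ 𝓓(Ω̃)`, the support of `T` is contained in `ℝ_*^d` (so that `1 / supp T` makes sense), and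
`(1 / supp T) K` is relatively compact in `Ω` for every compact `K ⊆ Ω`. -/
structure MemDH {𝕜 : Type*} [RCLike 𝕜] {d : ℕ} {Ω : Opens (Fin d → ℝ)}
    (T : DPrime 𝕜 (dilationHull Ω)) : Prop where
  maps_to : ∀ φ : 𝓓(dilationHull Ω, 𝕜), ∃ ψ : 𝓓(dilationHull Ω, 𝕜), IsTransform T φ ψ
  supp_subset : supp T ⊆ RStar d
  relativelyCompact : ∀ K : Set (Fin d → ℝ), IsCompact K → K ⊆ Ω →
    ∃ K' : Set (Fin d → ℝ), IsCompact K' ∧ K' ⊆ Ω ∧ (supp T)⁻¹ * K ⊆ K'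

/-- `R = S ⋆ T` in `𝓓'(Ω)`, for `S ∈ 𝓓'(Ω)` and `T ∈ 𝓓'(Ω̃)`: for every `φ ∈ 𝓓(Ω)` the function
`y ↦ T_x φ(x y)` is in `𝓓(Ω)` and `R φ = S_y (T_x φ(x y))`. -/
def IsMulConvolution {𝕜 : Type*} [RCLike 𝕜] {d : ℕ} {Ω : Opens (Fin d → ℝ)}
    (S : DPrime 𝕜 Ω) (T : DPrime 𝕜 (dilationHull Ω)) (R : DPrime 𝕜 Ω) : Prop :=
  ∀ φ : 𝓓(Ω, 𝕜), ∃ ψ : 𝓓(Ω, 𝕜), IsTransform T (incl φ) ψ ∧ R φ = S ψ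

end HadamardOp

/-
The space of test functions is Montel, hence semireflexive, so the operator `L` is the transpose of
a linear operator `M` on test functions. Since the monomials are eigenvectors of `L`, all moments of
`M φ` are fixed multiples of those of `φ`, and a compactly supported continuous function is
determined by its moments. As dilations preserve the moment relation, a partition of unity extends
`M` to an operator `N` on `𝓓(Ω̃)` which commutes with dilations, and `T φ = (N φ) 1` represents `L`.

Continuity of `L` for the strong topology bounds the supports of `M φ` by a compact set `K' ⊆ Ω` as
long as `supp φ` stays in a fixed compact set `K ⊆ Ω`. Hence `T` vanishes on `y⁻¹ K` whenever
`y ∉ K'`. At a point `x` with `x j = 0` the coordinate `y j` can be taken as large as we like, which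
excludes `x` from the support; for `x ∈ supp T` the same fact gives `x⁻¹ K ⊆ K'`.
-/

namespace HadamardOp

open Filter Set Bornology
open scoped Topology ContDiff BoundedContinuousFunction Manifold

section LocallyConvex

variable {𝕜 E E' : Type*} [RCLike 𝕜] [AddCommGroup E] [Module 𝕜 E] [TopologicalSpace E]
  [AddCommGroup E'] [Module 𝕜 E'] [TopologicalSpace E']

theorem mem_of_forall_dual_norm_le_one [IsTopologicalAddGroup E] [ContinuousSMul 𝕜 E]
    [Module ℝ E] [IsScalarTower ℝ 𝕜 E] [LocallyConvexSpace ℝ E] {A : Set E}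
    (hA : IsClosed A) (hconv : Convex ℝ A) (hbal : Balanced 𝕜 A) (hne : A.Nonempty) {x : E}
    (hx : ∀ f : E →L[𝕜] 𝕜, (∀ a ∈ A, ‖f a‖ ≤ 1) → ‖f x‖ ≤ 1) : x ∈ A := by
  by_contra hxA
  obtain ⟨f, r, hfr, hrx⟩ := RCLike.geometric_hahn_banach_closed_point (𝕜 := 𝕜) hconv hA hxA
  have hr : 0 < r := by simpa using hfr 0 (hbal.zero_mem hne)
  have hfA : ∀ a ∈ A, ‖f a‖ ≤ r := fun a ha => by
    obtain ⟨c, hc, hca⟩ := RCLike.exists_norm_eq_mul_self (f a)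
    have h := hfr (c • a) (hbal.smul_mem hc.le ha)
    rw [map_smul, smul_eq_mul, ← hca, RCLike.ofReal_re] at h
    exact h.le
  have hle : ‖(r : 𝕜)⁻¹‖ * ‖f x‖ ≤ 1 := by
    rw [← norm_smul]
    refine hx ((r : 𝕜)⁻¹ • f) fun a ha => ?_
    rw [smul_apply, norm_smul, norm_inv, RCLike.norm_ofReal, abs_of_pos hr,
      inv_mul_le_one₀ hr]
    exact hfA a ha
  rw [norm_inv, RCLike.norm_ofReal, abs_of_pos hr, inv_mul_le_one₀ hr] at hle
  exact ((hrx.trans_le (RCLike.re_le_norm _)).trans_le hle).false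

theorem exists_mem_forall_eq_apply [Module ℝ E] [IsScalarTower ℝ 𝕜 E] {A : Set E}
    (hA : IsCompact A) (hconv : Convex ℝ A) (hbal : Balanced 𝕜 A) (hne : A.Nonempty)
    (F : (E →L[𝕜] 𝕜) →ₗ[𝕜] 𝕜)
    (hF : ∀ S : E →L[𝕜] 𝕜, (∀ x ∈ A, ‖S x‖ ≤ 1) → ‖F S‖ ≤ 1) :
    ∃ x ∈ A, ∀ S : E →L[𝕜] 𝕜, F S = S x := by
  suffices h : (A ∩ ⋂ S : E →L[𝕜] 𝕜, {x | S x = F S}).Nonempty by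
    obtain ⟨x, hxA, hx⟩ := h
    exact ⟨x, hxA, fun S => (mem_iInter.1 hx S).symm⟩
  refine hA.inter_iInter_nonempty _ (fun S => isClosed_eq S.continuous continuous_const)
    fun u => ?_
  classical
  let Φ : E →L[𝕜] (u → 𝕜) := ContinuousLinearMap.pi fun S => S.1
  have hbalΦ : Balanced 𝕜 (Φ '' A) := by
    rintro c hc _ ⟨_, ⟨x, hx, rfl⟩, rfl⟩
    exact ⟨c • x, hbal.smul_mem hc hx, map_smul Φ c x⟩
  have hmem : (fun S : u => F S.1) ∈ Φ '' A := by
    refine mem_of_forall_dual_norm_le_one (𝕜 := 𝕜) (hA.image Φ.continuous).isClosed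
      (hconv.is_linear_image ⟨map_add Φ, fun c x => (Φ.restrictScalars ℝ).map_smul c x⟩)
      hbalΦ (hne.image Φ) fun f hf => ?_
    have hf_eq : ∀ w : u → 𝕜, f w = ∑ S : u, f (Pi.single S 1) * w S := fun w => by
      conv_lhs => rw [pi_eq_sum_univ' w]
      simp [map_sum, mul_comm]
    have hFf : F (f ∘L Φ) = f fun S : u => F S.1 := by
      have hcomp : f ∘L Φ = ∑ S : u, f (Pi.single S 1) • S.1 := by
        ext x
        rw [ContinuousLinearMap.comp_apply, hf_eq, sum_apply]
        rfl
      rw [hcomp, hf_eq]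
      simp only [map_sum, map_smul, smul_eq_mul]
    rw [← hFf]
    exact hF _ fun x hx => hf _ (mem_image_of_mem Φ hx)
  obtain ⟨x, hxA, hx⟩ := hmem
  exact ⟨x, hxA, mem_iInter₂.2 fun S hS => congrFun hx ⟨S, hS⟩⟩

theorem exists_isVonNBounded_forall_mem_of_mem_nhds {H : Type*} [AddCommGroup H] [Module 𝕜 H]
    [TopologicalSpace H] [ContinuousSMul 𝕜 E] (G : (E →L[𝕜] 𝕜) →L[𝕜] H) {V : Set H}
    (hV : V ∈ 𝓝 0) :
    ∃ B : Set E, IsVonNBounded 𝕜 B ∧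
      ∀ S : E →L[𝕜] 𝕜, (∀ x ∈ B, ‖S x‖ ≤ 1) → G S ∈ V := by
  obtain ⟨⟨B, W⟩, ⟨hB, hW⟩, hBW⟩ := (ContinuousLinearMap.hasBasis_nhds_zero (𝕜₁ := 𝕜) (𝕜₂ := 𝕜)
    (σ := RingHom.id 𝕜) (E := E) (F := 𝕜)).mem_iff.1 (G.continuous.tendsto' 0 0 (map_zero G) hV)
  obtain ⟨ε, hε, hεW⟩ := Metric.nhds_basis_closedBall.mem_iff.1 hW
  refine ⟨(ε : 𝕜)⁻¹ • B, hB.image ((ε : 𝕜)⁻¹ • ContinuousLinearMap.id 𝕜 E), fun S hS => ?_⟩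
  refine hBW fun x hx => hεW ?_
  have h := hS _ (smul_mem_smul_set hx)
  rw [map_smul, norm_smul, norm_inv, RCLike.norm_ofReal, abs_of_pos hε, inv_mul_le_one₀ hε] at h
  simpa using h

theorem exists_isVonNBounded_forall_apply_eq_zero [ContinuousSMul 𝕜 E]
    (L : (E →L[𝕜] 𝕜) →L[𝕜] E' →L[𝕜] 𝕜) {A : Set E'} (hA : IsVonNBounded 𝕜 A) :
    ∃ B : Set E, IsVonNBounded 𝕜 B ∧
      ∀ S : E →L[𝕜] 𝕜, (∀ x ∈ B, S x = 0) → ∀ w ∈ A, L S w = 0 := by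
  obtain ⟨B, hB, hBL⟩ := exists_isVonNBounded_forall_mem_of_mem_nhds L
    (ContinuousLinearMap.eventually_nhds_zero_mapsTo (σ := RingHom.id 𝕜) (F := 𝕜) hA
      (Metric.closedBall_mem_nhds (0 : 𝕜) one_pos))
  refine ⟨B, hB, fun S hS w hw => ?_⟩
  by_contra h0
  have hle := hBL ((2 / L S w) • S) (fun x hx => by simp [hS x hx]) hw
  rw [map_smul, smul_apply, smul_eq_mul, div_mul_cancel₀ _ h0, mem_closedBall_zero_iff,
    RCLike.norm_ofNat] at hle
  linarith

omit [TopologicalSpace E] in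
theorem balanced_convexHull_real [Module ℝ E] [IsScalarTower ℝ 𝕜 E] {s : Set E}
    (hs : Balanced 𝕜 s) : Balanced 𝕜 (convexHull ℝ s) := fun c hc => by
  have hc_lin : IsLinearMap ℝ fun x : E => c • x := ⟨smul_add c, fun r x => smul_comm c r x⟩
  rw [← image_smul, hc_lin.image_convexHull]
  exact convexHull_mono (hs c hc)

theorem isVonNBounded_convexHull_balancedHull [ContinuousSMul 𝕜 E] [Module ℝ E]
    [IsScalarTower ℝ 𝕜 E] [LocallyConvexSpace ℝ E] {B : Set E} (hB : IsVonNBounded 𝕜 B) :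
    IsVonNBounded 𝕜 (convexHull ℝ (balancedHull 𝕜 B)) := by
  intro U hU
  obtain ⟨V, ⟨hV, hVconv⟩, hVU⟩ := (LocallyConvexSpace.convex_basis (𝕜 := ℝ) (0 : E)).mem_iff.1 hU
  obtain ⟨W, ⟨hW, hWbal⟩, hWV⟩ := (nhds_basis_balanced 𝕜 E).mem_iff.1 hV
  filter_upwards [hB hW] with a ha
  have hconv : Convex ℝ (a • convexHull ℝ W) := (convex_convexHull ℝ W).is_linear_image
    (f := fun x => a • x) ⟨smul_add a, fun c x => smul_comm a c x⟩
  calc convexHull ℝ (balancedHull 𝕜 B) ⊆ a • convexHull ℝ W :=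
        convexHull_min (((balanced_convexHull_real hWbal).smul a).balancedHull_subset_of_subset
          (ha.trans (smul_set_mono (subset_convexHull ℝ W)))) hconv
    _ ⊆ a • U := smul_set_mono ((convexHull_min hWV hVconv).trans hVU)

theorem semireflexive_of_montelSpace [IsTopologicalAddGroup E] [ContinuousSMul 𝕜 E]
    [Module ℝ E] [IsScalarTower ℝ 𝕜 E] [LocallyConvexSpace ℝ E] [T3Space E]
    [MontelSpace 𝕜 E] (F : (E →L[𝕜] 𝕜) →L[𝕜] 𝕜) :
    ∃ x : E, ∀ S : E →L[𝕜] 𝕜, F S = S x := by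
  have : ContinuousConstSMul ℝ E :=
    ⟨fun c => by
      simpa only [algebraMap_smul] using continuous_const_smul (T := E) (algebraMap ℝ 𝕜 c)⟩
  obtain ⟨B, hB, hFB⟩ := exists_isVonNBounded_forall_mem_of_mem_nhds F
    (Metric.closedBall_mem_nhds 0 one_pos)
  let A := closure (convexHull ℝ (balancedHull 𝕜 (insert 0 B)))
  have hBA : insert 0 B ⊆ A :=
    (subset_balancedHull 𝕜).trans ((subset_convexHull ℝ _).trans subset_closure)
  obtain ⟨x, -, hx⟩ := exists_mem_forall_eq_apply (A := A)
    (MontelSpace.isCompact_of_isClosed_of_isVonNBounded 𝕜 isClosed_closure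
      (isVonNBounded_convexHull_balancedHull ((isVonNBounded_insert 0).2 hB)).closure)
    (convex_convexHull ℝ _).closure (balanced_convexHull_real (balancedHull.balanced _)).closure
    ⟨0, hBA (mem_insert 0 B)⟩ F.toLinearMap
    fun S hS => by simpa using hFB S fun y hy => hS y (hBA (mem_insert_of_mem 0 hy))
  exact ⟨x, hx⟩

theorem eq_of_forall_dual_eq [IsTopologicalAddGroup E] [ContinuousSMul 𝕜 E] [Module ℝ E]
    [IsScalarTower ℝ 𝕜 E] [LocallyConvexSpace ℝ E] [T1Space E] {x y : E}
    (h : ∀ f : E →L[𝕜] 𝕜, f x = f y) : x = y := by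
  by_contra hxy
  obtain ⟨f, hf⟩ := RCLike.geometric_hahn_banach_point_point (𝕜 := 𝕜) hxy
  exact hf.ne (congrArg RCLike.re (h f))

theorem exists_linearMap_forall_apply_eq [IsTopologicalAddGroup E] [ContinuousSMul 𝕜 E]
    [Module ℝ E] [IsScalarTower ℝ 𝕜 E] [LocallyConvexSpace ℝ E] [T3Space E]
    [MontelSpace 𝕜 E] [ContinuousSMul 𝕜 E'] (L : (E →L[𝕜] 𝕜) →L[𝕜] (E' →L[𝕜] 𝕜)) :
    ∃ M : E' →ₗ[𝕜] E, ∀ S x, L S x = S (M x) := by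
  let ev (x : E') : (E →L[𝕜] 𝕜) →L[𝕜] 𝕜 :=
    { toFun := fun S => L S x
      map_add' := fun S S' => by rw [map_add, add_apply]
      map_smul' := fun c S => by rw [map_smul, smul_apply, RingHom.id_apply]
      cont := (continuous_eval_const x).comp L.continuous }
  choose M hM using fun x => semireflexive_of_montelSpace (ev x)
  have hM' : ∀ S x, L S x = S (M x) := fun S x => hM x S
  refine ⟨⟨⟨M, fun x y => ?_⟩, fun c x => ?_⟩, hM'⟩ <;>
    refine eq_of_forall_dual_eq fun S : E →L[𝕜] 𝕜 => ?_
  · rw [← hM', map_add, hM', hM', ← map_add]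
  · rw [← hM', map_smul, hM', ← map_smul, RingHom.id_apply]

end LocallyConvex

theorem exists_isVonNBounded_range_smul {𝕜 E : Type*} [NontriviallyNormedField 𝕜] [AddCommGroup E]
    [Module 𝕜 E] [TopologicalSpace E] [IsTopologicalAddGroup E] [ContinuousSMul 𝕜 E]
    [FirstCountableTopology E] (x : ℕ → E) :
    ∃ c : ℕ → 𝕜, (∀ n, c n ≠ 0) ∧ IsVonNBounded 𝕜 (range fun n => c n • x n) := by
  obtain ⟨U, hU⟩ := (𝓝 (0 : E)).exists_antitone_basis
  have hex : ∀ n, ∃ c : 𝕜, c • x n ∈ U n ∧ c ≠ 0 := fun n => by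
    have hlim : Tendsto (fun c : 𝕜 => c • x n) (𝓝[≠] 0) (𝓝 0) :=
      ((continuous_id.smul continuous_const).tendsto' 0 0 (zero_smul 𝕜 _)).mono_left
        nhdsWithin_le_nhds
    exact ((hlim.eventually (hU.mem n)).and self_mem_nhdsWithin).exists
  choose c hcU hc using hex
  exact ⟨c, hc, (hU.tendsto hcU).isVonNBounded_range 𝕜⟩

theorem tendstoUniformly_of_lipschitzWith_of_eqOn_zero_compl {ι X V : Type*}
    [PseudoMetricSpace X] [NormedAddCommGroup V] {K : Set X} (hK : IsCompact K) {C : NNReal}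
    {l : Filter ι} [l.NeBot] {f : ι → X → V} {g : X → V} (hf : ∀ n, LipschitzWith C (f n))
    (hf0 : ∀ n, EqOn (f n) 0 Kᶜ) (hfg : ∀ x, Tendsto (fun n => f n x) l (𝓝 (g x))) :
    TendstoUniformly f g l := by
  have hg0 : EqOn g 0 Kᶜ := fun x hx =>
    tendsto_nhds_unique (hfg x) (tendsto_const_nhds.congr fun n => (hf0 n hx).symm)
  have hK_unif : TendstoUniformlyOn f g l K := by
    refine UniformOnFun.tendsto_iff_tendstoUniformlyOn.1
      ((EquicontinuousOn.tendsto_uniformOnFun_iff_pi' (𝔖 := {K}) (by simpa using hK)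
        (fun _ _ => (LipschitzWith.uniformEquicontinuous f C hf).equicontinuous.equicontinuousOn _)
        l g).2 (tendsto_pi_nhds.2 fun x => hfg x)) K rfl
  rw [Metric.tendstoUniformly_iff]
  intro ε hε
  filter_upwards [Metric.tendstoUniformlyOn_iff.1 hK_unif ε hε] with n hn x
  by_cases hx : x ∈ K
  · exact hn x hx
  · rwa [hg0 hx, hf0 n hx, dist_self]

section SmoothFunctions

variable {E F : Type*} [NormedAddCommGroup E] [NormedSpace ℝ E] [NormedAddCommGroup F]
  [NormedSpace ℝ F]

theorem lipschitzWith_iteratedFDeriv {f : E → F} (hf : ContDiff ℝ ∞ f) {i : ℕ} {C : ℝ}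
    (h : ∀ x, ‖iteratedFDeriv ℝ (i + 1) f x‖ ≤ C) :
    LipschitzWith C.toNNReal (iteratedFDeriv ℝ i f) := by
  refine lipschitzWith_of_nnnorm_fderiv_le (𝕜 := ℝ)
    (hf.differentiable_iteratedFDeriv (by exact_mod_cast ENat.natCast_lt_top i)) fun x => ?_
  rw [← NNReal.coe_le_coe, coe_nnnorm, norm_fderiv_iteratedFDeriv]
  exact (h x).trans (Real.le_coe_toNNReal C)

theorem hasFTaylorSeriesUpTo_of_tendstoUniformly {ι : Type*} {l : Filter ι} [l.NeBot]
    {f : ι → E → F} (hf : ∀ n, ContDiff ℝ ∞ (f n)) {g : E → FormalMultilinearSeries ℝ E F}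
    (hfg : ∀ i, TendstoUniformly (fun n => iteratedFDeriv ℝ i (f n)) (fun x => g x i) l) :
    HasFTaylorSeriesUpTo ∞ (fun x => (g x 0).curry0) g := by
  refine ⟨fun x => rfl, fun i _ x => ?_, fun i _ => ?_⟩
  · have hcurry := (continuousMultilinearCurryLeftEquiv ℝ (fun _ : Fin (i + 1) => E)
      F).lipschitz.uniformContinuous.comp_tendstoUniformly (hfg (i + 1))
    exact hasFDerivAt_of_tendstoUniformly hcurry
      (fun n x => (contDiff_iff_ftaylorSeries.1 (hf n)).fderiv i
        (by exact_mod_cast ENat.natCast_lt_top i) x)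
      (fun x => (hfg i).tendsto_at x) x
  · exact (hfg i).continuous (Frequently.of_forall fun n =>
      (hf n).continuous_iteratedFDeriv (by exact_mod_cast le_top))

theorem tendsto_nhds_iff_tendstoUniformly_iteratedFDeriv {ι : Type*} {l : Filter ι}
    {K : Compacts E} {f : ι → 𝓓_{K}(E, F)} {g : 𝓓_{K}(E, F)} :
    Tendsto f l (𝓝 g) ↔
      ∀ i, TendstoUniformly (fun n => iteratedFDeriv ℝ i (f n)) (iteratedFDeriv ℝ i g) l := by
  rw [(ContDiffMapSupportedIn.isUniformEmbedding_pi_structureMapCLM ℝ).isInducing.tendsto_nhds_iff,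
    tendsto_pi_nhds]
  refine forall_congr' fun i => ?_
  rw [BoundedContinuousFunction.tendsto_iff_tendstoUniformly]
  simp only [Function.comp_apply, ContinuousLinearMap.pi_apply,
    ContDiffMapSupportedIn.structureMapCLM_top_apply]

variable [FiniteDimensional ℝ E] [FiniteDimensional ℝ F]

theorem finiteDimensional_continuousMultilinearMap (i : ℕ) :
    FiniteDimensional ℝ (E [×i]→L[ℝ] F) :=
  FiniteDimensional.of_injective
    (ContinuousMultilinearMap.toMultilinearMapLinear :
      (E [×i]→L[ℝ] F) →ₗ[ℝ] MultilinearMap ℝ (fun _ : Fin i => E) F)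
    ContinuousMultilinearMap.toMultilinearMap_injective

theorem exists_tendsto_iteratedFDeriv {ι : Type*} (U : Ultrafilter ι) {f : ι → E → F} {i : ℕ}
    {C : ℝ} {x : E} (hf : ∀ n, ‖iteratedFDeriv ℝ i (f n) x‖ ≤ C) :
    ∃ g : E [×i]→L[ℝ] F, Tendsto (fun n => iteratedFDeriv ℝ i (f n) x) U (𝓝 g) := by
  have := finiteDimensional_continuousMultilinearMap (E := E) (F := F) i
  have : ProperSpace (E [×i]→L[ℝ] F) := FiniteDimensional.proper_real _
  obtain ⟨g, -, hg⟩ := isCompact_iff_ultrafilter_le_nhds.1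
    (isCompact_closedBall (0 : E [×i]→L[ℝ] F) C)
    (U.map fun n => iteratedFDeriv ℝ i (f n) x)
    (tendsto_principal.2 (.of_forall fun n => mem_closedBall_zero_iff.2 (hf n)))
  exact ⟨g, hg⟩

theorem isCompact_setOf_norm_iteratedFDeriv_le (K : Compacts E) (C : ℕ → ℝ) :
    IsCompact {f : 𝓓_{K}(E, F) | ∀ i x, ‖iteratedFDeriv ℝ i f x‖ ≤ C i} := by
  set A := {f : 𝓓_{K}(E, F) | ∀ i x, ‖iteratedFDeriv ℝ i f x‖ ≤ C i}
  refine isCompact_iff_compactSpace.2 ⟨isCompact_iff_ultrafilter_le_nhds.2 fun U _ => ?_⟩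
  choose g hg using fun i x => exists_tendsto_iteratedFDeriv U (f := fun f : A => f.1)
    fun f => f.2 i x
  have hunif : ∀ i, TendstoUniformly (fun f : A => iteratedFDeriv ℝ i f.1) (g i) U := fun i =>
    tendstoUniformly_of_lipschitzWith_of_eqOn_zero_compl K.isCompact
      (fun f : A => lipschitzWith_iteratedFDeriv f.1.contDiff (f.2 (i + 1)))
      (fun f _ hx => f.1.iteratedFDeriv_zero_on_compl hx) (hg i)
  have htaylor := hasFTaylorSeriesUpTo_of_tendstoUniformly (f := fun f : A => f.1)
    (g := fun x i => g i x) (fun f => f.1.contDiff) hunif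
  let ψ : 𝓓_{K}(E, F) := ⟨fun x => (g 0 x).curry0, htaylor.contDiff, fun x hx => by
    have h0 : g 0 x = 0 := tendsto_nhds_unique (hg 0 x) (tendsto_const_nhds.congr fun f : A =>
      (f.1.iteratedFDeriv_zero_on_compl hx).symm)
    simp [h0]⟩
  have hψ : ∀ i, iteratedFDeriv ℝ i ψ = g i := fun i => funext fun x =>
    (htaylor.eq_iteratedFDeriv (by exact_mod_cast le_top) x).symm
  refine ⟨⟨ψ, fun i x => ?_⟩, mem_univ _, ?_⟩
  · rw [hψ]
    exact le_of_tendsto' (hg i x).norm fun f : A => f.2 i x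
  · have hlim : Tendsto (fun f : A => f.1) U (𝓝 ψ) :=
      tendsto_nhds_iff_tendstoUniformly_iteratedFDeriv.2 fun i => by
        rw [hψ]
        exact hunif i
    exact Topology.IsInducing.subtypeVal.tendsto_nhds_iff.2 hlim

end SmoothFunctions

section TestFunction

variable {𝕜 E F : Type*} [RCLike 𝕜] [NormedAddCommGroup E] [NormedSpace ℝ E]
  [NormedAddCommGroup F] [NormedSpace ℝ F] {Ω : Opens E}

/-- A test function as an element of the space of smooth functions supported in `tsupport φ`. -/
noncomputable def toSupportedIn (φ : 𝓓(Ω, F)) : 𝓓_{⟨tsupport φ, φ.hasCompactSupport⟩}(E, F) :=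
  .of_support_subset φ.contDiff (subset_tsupport φ)

variable [NormedSpace 𝕜 F] [IsScalarTower ℝ 𝕜 F]

instance instContinuousSMulTestFunction {n : ℕ∞} : ContinuousSMul 𝕜 𝓓^{n}(Ω, F) where
  continuous_smul := by
    -- The LF-topology is defined over `ℝ`, so split the scalar into its real and imaginary parts.
    have h : ∀ p : 𝕜 × 𝓓^{n}(Ω, F), p.1 • p.2 = RCLike.re p.1 • p.2 + RCLike.im p.1 •
        TestFunction.postcompCLM ((RCLike.I : 𝕜) • ContinuousLinearMap.id 𝕜 F) p.2 := fun p => by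
      ext x
      change p.1 • p.2 x = RCLike.re p.1 • p.2 x + RCLike.im p.1 • (RCLike.I : 𝕜) • p.2 x
      rw [RCLike.real_smul_eq_coe_smul (K := 𝕜), RCLike.real_smul_eq_coe_smul (K := 𝕜), smul_smul,
        ← add_smul, RCLike.re_add_im]
    simp_rw [h]
    fun_prop

theorem exists_norm_iteratedFDeriv_le_of_isVonNBounded {B : Set 𝓓(Ω, F)}
    (hB : IsVonNBounded 𝕜 B) (i : ℕ) : ∃ C : ℝ, ∀ φ ∈ B, ∀ x, ‖iteratedFDeriv ℝ i φ x‖ ≤ C := by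
  have : IsTopologicalAddGroup (E →ᵇ E [×i]→L[ℝ] F) :=
    @SeminormedAddCommGroup.toIsTopologicalAddGroup _
      BoundedContinuousFunction.instSeminormedAddCommGroup
  have : LocallyConvexSpace ℝ (E →ᵇ E [×i]→L[ℝ] F) :=
    @NormedSpace.toLocallyConvexSpace _ BoundedContinuousFunction.instSeminormedAddCommGroup _
  let D : 𝓓(Ω, F) →L[𝕜] E →ᵇ E [×i]→L[ℝ] F :=
    TestFunction.limitCLM (V := E →ᵇ E [×i]→L[ℝ] F) 𝕜
      (fun φ : 𝓓(Ω, F) => ContDiffMapSupportedIn.structureMapCLM 𝕜 ⊤ i (toSupportedIn φ))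
      (fun K _ => (ContDiffMapSupportedIn.structureMapCLM 𝕜 ⊤ i : 𝓓_{K}(E, F) →L[𝕜] _))
      fun _ _ _ => by
        ext1 x
        simp only [ContDiffMapSupportedIn.structureMapCLM_top_apply]
        rfl
  have hD (φ : 𝓓(Ω, F)) : ⇑(D φ) = iteratedFDeriv ℝ i φ :=
    ContDiffMapSupportedIn.structureMapCLM_top_apply 𝕜 (toSupportedIn φ)
  have hDB : IsVonNBounded 𝕜 (D '' B) :=
    IsVonNBounded.image (σ := RingHom.id 𝕜) (F := E →ᵇ E [×i]→L[ℝ] F) hB D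
  obtain ⟨C, hC⟩ := isBounded_iff_forall_norm_le.1 ((NormedSpace.isVonNBounded_iff 𝕜
    (E := E →ᵇ E [×i]→L[ℝ] F)).1 hDB)
  refine ⟨C, fun φ hφ x => ?_⟩
  rw [← hD]
  exact ((D φ).norm_coe_le_norm x).trans (hC _ (mem_image_of_mem _ hφ))

theorem exists_norm_smul_apply_le_of_isVonNBounded {x : ℕ → E}
    (hx : ∀ K : Compacts E, (K : Set E) ⊆ Ω → ∀ᶠ n in atTop, x n ∉ K) (c : ℕ → 𝕜)
    {B : Set 𝓓(Ω, F)} (hB : IsVonNBounded 𝕜 B) :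
    ∃ C : ℝ, ∀ φ ∈ B, ∀ n, ‖c n • φ (x n)‖ ≤ C := by
  choose N hN using fun K hK => eventually_atTop.1 (hx K hK)
  -- Each compact subset of `Ω` contains only finitely many `x n`, so `φ ↦ (c n • φ (x n))ₙ` is a
  -- continuous map into `ℓ^∞`.
  let T (K : Compacts E) (hK : (K : Set E) ⊆ Ω) : 𝓓_{K}(E, F) →L[𝕜] lp (fun _ : ℕ => F) ⊤ :=
    ∑ n ∈ Finset.range (N K hK), c n • lp.singleContinuousLinearMap 𝕜 (fun _ => F) ⊤ n ∘L
      BoundedContinuousFunction.evalCLM 𝕜 (x n) ∘L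
        ContDiffMapSupportedIn.toBoundedContinuousFunctionCLM 𝕜
  have hT : ∀ K hK (f : 𝓓_{K}(E, F)) n, T K hK f n = c n • f (x n) := fun K hK f n => by
    calc T K hK f n = ∑ m ∈ Finset.range (N K hK), c m • (Pi.single m (f (x m)) : ℕ → F) n := by
          simp only [T, sum_apply, lp.coeFn_sum, Finset.sum_apply]
          rfl
      _ = c n • f (x n) := by
          rw [Finset.sum_eq_single n]
          · rw [Pi.single_eq_same]
          · intro m _ hmn
            rw [Pi.single_eq_of_ne' hmn, smul_zero]
          · intro hn
            rw [Pi.single_eq_same, f.zero_on_compl (hN K hK n (by simpa using hn)), Pi.zero_apply,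
              smul_zero]
  let W : 𝓓(Ω, F) →L[𝕜] lp (fun _ : ℕ => F) ⊤ := TestFunction.limitCLM 𝕜
    (fun φ => T ⟨tsupport φ, φ.hasCompactSupport⟩ φ.tsupport_subset (toSupportedIn φ)) T
    fun K hK f => by
      ext n
      rw [hT, hT]
      rfl
  obtain ⟨C, hC⟩ := ((NormedSpace.isVonNBounded_iff 𝕜).1 (hB.image W)).exists_norm_le
  refine ⟨C, fun φ hφ n => ?_⟩
  calc ‖c n • φ (x n)‖ = ‖W φ n‖ := congrArg norm (hT _ _ (toSupportedIn φ) n).symm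
    _ ≤ ‖W φ‖ := lp.norm_apply_le_norm ENNReal.top_ne_zero _ n
    _ ≤ C := hC _ (mem_image_of_mem W hφ)

/-- Evaluation at a point, as a distribution. -/
noncomputable def dirac (𝕜 : Type*) [RCLike 𝕜] (Ω : Opens E) (x : E) : 𝓓(Ω, 𝕜) →L[𝕜] 𝕜 where
  toFun φ := φ x
  map_add' _ _ := rfl
  map_smul' _ _ := rfl
  cont := continuous_eval_const x

@[simp]
theorem dirac_apply (x : E) (φ : 𝓓(Ω, 𝕜)) : dirac 𝕜 Ω x φ = φ x := rfl

variable [FiniteDimensional ℝ E]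

theorem exists_compact_exhaustion (Ω : Opens E) :
    ∃ K : ℕ → Compacts E, (∀ n, (K n : Set E) ⊆ Ω) ∧
      ∀ C : Compacts E, (C : Set E) ⊆ Ω → ∀ᶠ n in atTop, (C : Set E) ⊆ K n := by
  have : ProperSpace E := FiniteDimensional.proper_real E
  have : LocallyCompactSpace Ω := Ω.isOpen.locallyCompactSpace
  have : SigmaCompactSpace Ω := sigmaCompactSpace_of_locallyCompact_secondCountable
  let e : CompactExhaustion Ω := default
  refine ⟨fun n => ⟨(↑) '' e n, (e.isCompact n).image continuous_subtype_val⟩,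
    fun n => Subtype.coe_image_subset _ _, fun C hC => ?_⟩
  have hC' : IsCompact ((↑) ⁻¹' (C : Set E) : Set Ω) :=
    Topology.IsInducing.subtypeVal.isCompact_preimage' C.isCompact (by simpa using hC)
  obtain ⟨n, hn⟩ := e.exists_superset_of_isCompact hC'
  exact eventually_atTop.2 ⟨n, fun m hm x hx => ⟨⟨x, hC hx⟩, e.subset hm (hn hx), rfl⟩⟩

theorem exists_compact_forall_tsupport_subset {B : Set 𝓓(Ω, F)} (hB : IsVonNBounded 𝕜 B) :
    ∃ K : Compacts E, (K : Set E) ⊆ Ω ∧ ∀ φ ∈ B, tsupport φ ⊆ K := by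
  by_contra! h
  obtain ⟨K, hKΩ, hK⟩ := exists_compact_exhaustion Ω
  have hout : ∀ n, ∃ φ ∈ B, ∃ x, φ x ≠ 0 ∧ x ∉ K n := fun n => by
    obtain ⟨φ, hφ, hn⟩ := h (K n) (hKΩ n)
    by_contra! h0
    exact hn (closure_minimal (h0 φ hφ) (K n).isCompact.isClosed)
  choose φ hφB x hφx hx using hout
  obtain ⟨C, hC⟩ := exists_norm_smul_apply_le_of_isVonNBounded
    (fun Q hQ => (hK Q hQ).mono fun n hn hxQ => hx n (hn hxQ))
    (fun n => ((n / ‖φ n (x n)‖ : ℝ) : 𝕜)) hB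
  obtain ⟨n, hn⟩ := exists_nat_gt C
  have hle := hC (φ n) (hφB n) n
  rw [norm_smul, RCLike.norm_ofReal, abs_of_nonneg (by positivity),
    div_mul_cancel₀ _ (norm_ne_zero_iff.2 (hφx n))] at hle
  exact hn.not_ge hle

instance instMontelSpaceTestFunction [FiniteDimensional ℝ F] : MontelSpace 𝕜 𝓓(Ω, F) where
  heine_borel B hBclosed hB := by
    obtain ⟨K, hKΩ, hK⟩ := exists_compact_forall_tsupport_subset hB
    choose C hC using exists_norm_iteratedFDeriv_le_of_isVonNBounded hB
    refine ((isCompact_setOf_norm_iteratedFDeriv_le K C).image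
      (TestFunction.continuous_ofSupportedIn hKΩ)).of_isClosed_subset hBclosed fun φ hφ => ?_
    exact ⟨.of_support_subset φ.contDiff ((subset_tsupport φ).trans (hK φ hφ)),
      fun i => hC i φ hφ, rfl⟩

instance instFirstCountableTopologyContDiffMapSupportedIn {n : ℕ∞} (K : Compacts E) :
    FirstCountableTopology 𝓓^{n}_{K}(E, F) :=
  (ContDiffMapSupportedIn.withSeminorms' ℝ E F n K).firstCountableTopology

theorem exists_compact_forall_tsupport_transpose_subset {V W : Type*} [AddCommGroup V] [Module 𝕜 V]
    [TopologicalSpace V] [IsTopologicalAddGroup V] [ContinuousSMul 𝕜 V] [FirstCountableTopology V]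
    [AddCommGroup W] [Module 𝕜 W] [TopologicalSpace W]
    {L : (𝓓(Ω, 𝕜) →L[𝕜] 𝕜) →L[𝕜] W →L[𝕜] 𝕜} {M : W →ₗ[𝕜] 𝓓(Ω, 𝕜)}
    (hM : ∀ S w, L S w = S (M w)) (J : V →L[𝕜] W) :
    ∃ K : Compacts E, (K : Set E) ⊆ Ω ∧ ∀ v, tsupport (M (J v)) ⊆ K := by
  by_contra! h
  obtain ⟨Q, hQΩ, hQ⟩ := exists_compact_exhaustion Ω
  choose v hv using fun n => h (Q n) (hQΩ n)
  obtain ⟨c, hc, hbdd⟩ := exists_isVonNBounded_range_smul (𝕜 := 𝕜) v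
  obtain ⟨B, hB, hBL⟩ := exists_isVonNBounded_forall_apply_eq_zero L
    (hbdd.image (σ := RingHom.id 𝕜) J)
  obtain ⟨K, hKΩ, hK⟩ := exists_compact_forall_tsupport_subset hB
  obtain ⟨n, hn⟩ := (hQ K hKΩ).exists
  refine hv n ((closure_minimal (fun y hy => ?_) K.isCompact.isClosed).trans hn)
  by_contra hyK
  have hy0 : L (dirac 𝕜 Ω y) (J (c n • v n)) = 0 :=
    hBL _ (fun φ hφ => image_eq_zero_of_notMem_tsupport (f := φ) fun h => hyK (hK φ hφ h)) _
      (mem_image_of_mem J (mem_range_self n))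
  rw [map_smul, map_smul, smul_eq_mul, mul_eq_zero, or_iff_right (hc n), hM] at hy0
  exact hy hy0

end TestFunction

section Moments

variable {𝕜 : Type*} [RCLike 𝕜]

theorem integral_mul_eq_zero_of_dense_span {X : Type*} [TopologicalSpace X] [CompactSpace X]
    [MeasurableSpace X] [BorelSpace X] {μ : Measure X} [IsFiniteMeasure μ] {s : Set C(X, 𝕜)}
    (hs : Dense (Submodule.span 𝕜 s : Set C(X, 𝕜))) {g : C(X, 𝕜)}
    (hg : ∀ f ∈ s, ∫ x, g x * f x ∂μ = 0) (f : C(X, 𝕜)) : ∫ x, g x * f x ∂μ = 0 := by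
  have hint (f : C(X, 𝕜)) : Integrable (fun x => g x * f x) μ :=
    (g * f).continuous.integrable_of_hasCompactSupport (.of_compactSpace _)
  let Φ : C(X, 𝕜) →L[𝕜] 𝕜 :=
    { toFun := fun f => ∫ x, g x * f x ∂μ
      map_add' := fun p q => by
        simp_rw [ContinuousMap.add_apply, mul_add]
        exact integral_add (hint p) (hint q)
      map_smul' := fun c p => by
        simp_rw [ContinuousMap.smul_apply, mul_smul_comm]
        exact integral_smul c _
      cont := (continuous_integral.comp ((ContinuousMap.toLp 1 μ 𝕜).continuous.comp
        (continuous_const_mul g))).congr fun f =>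
          integral_congr_ae (ContinuousMap.coeFn_toLp μ (g * f)) }
  have hΦ : Φ = 0 := ContinuousLinearMap.ext_on hs hg
  exact DFunLike.congr_fun hΦ f

/-- The `i`-th coordinate, as a continuous `𝕜`-valued function on `K`. -/
def coordinate (𝕜 : Type*) [RCLike 𝕜] {ι : Type*} (K : Set (ι → ℝ)) (i : ι) : C(K, 𝕜) :=
  ⟨fun x => (x.1 i : 𝕜),
    RCLike.continuous_ofReal.comp ((continuous_apply i).comp continuous_subtype_val)⟩

theorem separatesPoints_adjoin_range_coordinate {ι : Type*} (K : Set (ι → ℝ)) :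
    (StarAlgebra.adjoin 𝕜 (range (coordinate 𝕜 K))).SeparatesPoints := fun x y hxy => by
  obtain ⟨i, hi⟩ := Function.ne_iff.1 (Subtype.coe_ne_coe.2 hxy)
  exact ⟨coordinate 𝕜 K i, ⟨_, StarAlgebra.subset_adjoin 𝕜 _ (mem_range_self i), rfl⟩,
    RCLike.ofReal_injective.ne hi⟩

variable {d : ℕ}

theorem dense_span_range_restrict_monomialFun (K : Set (Fin d → ℝ)) [CompactSpace K] :
    Dense (Submodule.span 𝕜 (range fun α =>
      (⟨monomialFun 𝕜 α, continuous_monomialFun 𝕜 α⟩ : C(Fin d → ℝ, 𝕜)).restrict K) :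
        Set C(K, 𝕜)) := by
  have hself : star ∘ coordinate 𝕜 K = coordinate 𝕜 K := by
    ext i x
    exact RCLike.conj_ofReal _
  have hdense : Dense (StarAlgebra.adjoin 𝕜 (range (coordinate 𝕜 K)) : Set C(K, 𝕜)) := by
    rw [dense_iff_closure_eq, ← StarSubalgebra.topologicalClosure_coe,
      ContinuousMap.starSubalgebra_topologicalClosure_eq_top_of_separatesPoints _
        (separatesPoints_adjoin_range_coordinate K), StarSubalgebra.coe_top]
  refine hdense.mono fun f hf => ?_
  rw [SetLike.mem_coe, ← StarSubalgebra.mem_toSubalgebra, StarAlgebra.adjoin_toSubalgebra,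
    ← image_star, ← range_comp, hself, union_self, ← Subalgebra.mem_toSubmodule,
    Algebra.adjoin_eq_span] at hf
  refine Submodule.span_mono (fun p hp => ?_) hf
  obtain ⟨α, rfl⟩ := Submonoid.exists_of_mem_closure_range _ _ hp
  refine ⟨α, ?_⟩
  ext x
  simp [monomialFun, coordinate]

theorem eq_zero_of_forall_integral_mul_monomialFun_eq_zero {g : (Fin d → ℝ) → 𝕜}
    (hg : Continuous g) (hgc : HasCompactSupport g)
    (h : ∀ α, ∫ x, g x * monomialFun 𝕜 α x = 0) : g = 0 := by
  have : CompactSpace (tsupport g) := isCompact_iff_compactSpace.1 hgc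
  have hemb := MeasurableEmbedding.subtype_coe (isClosed_tsupport g).measurableSet
  have := IsFiniteMeasureOnCompacts.comap' volume continuous_subtype_val hemb
  let G : C(Fin d → ℝ, 𝕜) := ⟨g, hg⟩
  have hrestrict (f : C(Fin d → ℝ, 𝕜)) :
      ∫ x, G.restrict (tsupport g) x * f.restrict (tsupport g) x ∂volume.comap Subtype.val =
        ∫ x, g x * f x := by
    refine (integral_subtype_comap (isClosed_tsupport g).measurableSet fun x => g x * f x).trans
      (setIntegral_eq_integral_of_forall_compl_eq_zero fun x hx => ?_)
    rw [image_eq_zero_of_notMem_tsupport hx, zero_mul]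
  have hconj : ∫ x, g x * star (g x) = 0 := (hrestrict (star G)).symm.trans <|
    integral_mul_eq_zero_of_dense_span (dense_span_range_restrict_monomialFun (tsupport g))
      (forall_mem_range.2 fun α => (hrestrict _).trans (h α)) _
  have hnorm : ∫ x, ‖g x‖ ^ 2 = 0 := by
    refine RCLike.ofReal_injective (K := 𝕜) ?_
    rw [← integral_ofReal, RCLike.ofReal_zero, ← hconj]
    refine integral_congr_ae (.of_forall fun x => ?_)
    exact_mod_cast (RCLike.mul_conj (g x)).symm
  by_contra hne
  obtain ⟨x, hx⟩ := Function.ne_iff.1 hne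
  exact hnorm.not_gt (Continuous.integral_pos_of_hasCompactSupport_nonneg_nonzero (by fun_prop)
    (hgc.comp_left (g := fun z => ‖z‖ ^ 2) (by simp)) (fun x => by positivity)
    (pow_ne_zero 2 (norm_ne_zero_iff.2 hx)))

/-- The moments of `ψ` arise from those of `φ` through multiplication by `m`. -/
def HasMoments (m : (Fin d → ℕ) → 𝕜) (φ ψ : (Fin d → ℝ) → 𝕜) : Prop :=
  ∀ α, ∫ x, ψ x * monomialFun 𝕜 α x = m α * ∫ x, φ x * monomialFun 𝕜 α x

theorem integrable_mul_monomialFun {φ : (Fin d → ℝ) → 𝕜} (hφ : Continuous φ)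
    (hφc : HasCompactSupport φ) (α : Fin d → ℕ) :
    Integrable fun x => φ x * monomialFun 𝕜 α x :=
  (hφ.mul (continuous_monomialFun 𝕜 α)).integrable_of_hasCompactSupport hφc.mul_right

theorem HasMoments.unique {m : (Fin d → ℕ) → 𝕜} {φ ψ₁ ψ₂ : (Fin d → ℝ) → 𝕜}
    (h₁ : HasMoments m φ ψ₁) (h₂ : HasMoments m φ ψ₂) (hc₁ : Continuous ψ₁) (hc₂ : Continuous ψ₂)
    (hs₁ : HasCompactSupport ψ₁) (hs₂ : HasCompactSupport ψ₂) : ψ₁ = ψ₂ := by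
  refine sub_eq_zero.1
    (eq_zero_of_forall_integral_mul_monomialFun_eq_zero (hc₁.sub hc₂) (hs₁.sub hs₂) fun α => ?_)
  simp_rw [Pi.sub_apply, sub_mul]
  rw [integral_sub (integrable_mul_monomialFun hc₁ hs₁ α)
    (integrable_mul_monomialFun hc₂ hs₂ α), h₁, h₂, sub_self]

theorem HasMoments.sum {m : (Fin d → ℕ) → 𝕜} {κ : Type*} (s : Finset κ)
    {φ ψ : κ → (Fin d → ℝ) → 𝕜} (h : ∀ i ∈ s, HasMoments m (φ i) (ψ i))
    (hφ : ∀ i ∈ s, Continuous (φ i)) (hφs : ∀ i ∈ s, HasCompactSupport (φ i))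
    (hψ : ∀ i ∈ s, Continuous (ψ i)) (hψs : ∀ i ∈ s, HasCompactSupport (ψ i)) :
    HasMoments m (fun x => ∑ i ∈ s, φ i x) (fun x => ∑ i ∈ s, ψ i x) := by
  intro α
  simp_rw [Finset.sum_mul]
  rw [integral_finsetSum _ fun i hi => integrable_mul_monomialFun (hφ i hi) (hφs i hi) α,
    integral_finsetSum _ fun i hi => integrable_mul_monomialFun (hψ i hi) (hψs i hi) α,
    Finset.mul_sum]
  exact Finset.sum_congr rfl fun i hi => h i hi α

theorem exists_integral_comp_mul_right {a : Fin d → ℝ} (ha : a ∈ RStar d) :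
    ∃ c : ℝ, ∀ g : (Fin d → ℝ) → 𝕜, ∫ x, g (x * a) = c • ∫ x, g x := by
  let f : (Fin d → ℝ) →ₗ[ℝ] (Fin d → ℝ) := LinearMap.mulRight ℝ a
  have hbij : Function.Bijective f := (dilation a ha).bijective
  have hdet : LinearMap.det f ≠ 0 :=
    ((LinearEquiv.ofBijective f hbij).isUnit_det').ne_zero
  refine ⟨(ENNReal.ofReal |(LinearMap.det f)⁻¹|).toReal, fun g => ?_⟩
  rw [← integral_smul_measure, ← Measure.map_linearMap_addHaar_eq_smul_addHaar volume hdet]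
  exact ((dilation a ha).toMeasurableEquiv.measurableEmbedding.integral_map g).symm

theorem HasMoments.comp_mul_right {m : (Fin d → ℕ) → 𝕜} {φ ψ : (Fin d → ℝ) → 𝕜}
    (h : HasMoments m φ ψ) {a : Fin d → ℝ} (ha : a ∈ RStar d) :
    HasMoments m (fun x => φ (x * a)) (fun x => ψ (x * a)) := by
  obtain ⟨c, hc⟩ := exists_integral_comp_mul_right (𝕜 := 𝕜) ha
  intro α
  have hne : monomialFun 𝕜 α a ≠ 0 :=
    Finset.prod_ne_zero_iff.2 fun i _ => pow_ne_zero _ (RCLike.ofReal_ne_zero.2 (ha i))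
  have hmul : ∀ x, monomialFun 𝕜 α (x * a) = monomialFun 𝕜 α x * monomialFun 𝕜 α a := fun x => by
    simp [monomialFun, mul_pow, Finset.prod_mul_distrib]
  have key : ∀ f : (Fin d → ℝ) → 𝕜, (∫ x, f (x * a) * monomialFun 𝕜 α x) * monomialFun 𝕜 α a =
      c • ∫ x, f x * monomialFun 𝕜 α x := fun f => by
    rw [← integral_mul_const, ← hc]
    simp_rw [hmul, mul_assoc]
  apply mul_right_cancel₀ hne
  rw [key, mul_assoc, key, h α, mul_smul_comm]

end Moments

section Localization

variable {𝕜 : Type*} [RCLike 𝕜] {E : Type*} [NormedAddCommGroup E] [NormedSpace ℝ E]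
  {K K' : Compacts E}

/-- Composition with a linear map `g`, as an operator from the test functions supported in `K` to
those supported in `K' ⊇ g ⁻¹' K`. -/
noncomputable def compLinearCLM (𝕜 : Type*) [RCLike 𝕜] (g : E →L[ℝ] E) (h : g ⁻¹' K ⊆ K') :
    𝓓_{K}(E, 𝕜) →L[𝕜] 𝓓_{K'}(E, 𝕜) :=
  ContDiffMapSupportedIn.mkCLM 𝕜 (fun f x => f (g x)) (fun _ _ _ => rfl) (fun _ _ _ => rfl)
    (fun f => f.contDiff.comp g.contDiff) (fun f x hx => f.zero_on_compl fun hx' => hx (h hx'))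
    fun i _ => ⟨{i}, ‖g‖ ^ i, by positivity, fun f x _ => calc
      ‖iteratedFDeriv ℝ i (f ∘ g) x‖ ≤ ‖iteratedFDeriv ℝ i f (g x)‖ * ∏ _j : Fin i, ‖g‖ := by
        rw [g.iteratedFDeriv_comp_right f.contDiff x (by exact_mod_cast le_top)]
        exact ContinuousMultilinearMap.norm_compContinuousLinearMap_le _ _
      _ ≤ ‖g‖ ^ i * ({i} : Finset ℕ).sup
          (ContDiffMapSupportedIn.seminorm 𝕜 E 𝕜 ⊤ K) f := by
        rw [Finset.sup_singleton, Finset.prod_const, Finset.card_univ, Fintype.card_fin, mul_comm]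
        gcongr
        exact ContDiffMapSupportedIn.norm_iteratedFDeriv_apply_le_seminorm_top 𝕜⟩

/-- Multiplication by a smooth function `χ`, as an operator from the test functions supported in
`K` to those supported in `K' ⊇ K ∩ tsupport χ`. -/
noncomputable def mulSmoothCLM {χ : E → 𝕜} (hχ : ContDiff ℝ ∞ χ)
    (h : (K : Set E) ∩ tsupport χ ⊆ K') : 𝓓_{K}(E, 𝕜) →L[𝕜] 𝓓_{K'}(E, 𝕜) where
  toFun f := ContDiffMapSupportedIn.of_support_subset (f.contDiff.mul hχ) fun _ hx =>
    h ⟨f.support_subset (left_ne_zero_of_mul hx), subset_tsupport χ (right_ne_zero_of_mul hx)⟩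
  map_add' f g := by ext x; exact add_mul _ _ _
  map_smul' c f := by ext x; exact mul_assoc _ _ _
  cont := by
    rw [ContDiffMapSupportedIn.continuous_iff_comp]
    intro i
    refine ((ContDiffMapSupportedIn.structureMapCLM ℝ ⊤ i).continuous.comp
      (ContDiffMapSupportedIn.bilinLeftCLM (n := ⊤) (K := K) (ContinuousLinearMap.mul 𝕜 𝕜)
        hχ).continuous).congr fun f => ?_
    ext1 x
    exact (congrFun (ContDiffMapSupportedIn.structureMapCLM_top_apply ℝ _) x).trans
      (congrFun (ContDiffMapSupportedIn.structureMapCLM_top_apply ℝ _) x).symm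

theorem exists_contDiff_finsetSum_eq_one [FiniteDimensional ℝ E] {s : Set E} (hs : IsCompact s)
    {ι : Type*} {U : ι → Set E} (hU : ∀ i, IsOpen (U i)) (hsU : s ⊆ ⋃ i, U i) :
    ∃ (t : Finset ι) (χ : ι → E → ℝ), (∀ i, ContDiff ℝ ∞ (χ i)) ∧
      (∀ i, tsupport (χ i) ⊆ U i) ∧ ∀ x ∈ s, ∑ i ∈ t, χ i x = 1 := by
  obtain ⟨χ, hχU⟩ := SmoothPartitionOfUnity.exists_isSubordinate 𝓘(ℝ, E) hs.isClosed U hU hsU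
  have hfin := χ.locallyFinite.finite_nonempty_inter_compact hs
  refine ⟨hfin.toFinset, fun i => χ i, fun i => (χ i).contMDiff.contDiff, hχU, fun x hx => ?_⟩
  rw [← χ.sum_eq_one hx]
  exact (finsum_eq_sum_of_support_subset _ fun i hi =>
    hfin.mem_toFinset.2 ⟨x, hi, hx⟩).symm

variable {d : ℕ} {Ω : Opens (Fin d → ℝ)}

theorem mem_dilationHull_iff_exists_dilation_mem {x : Fin d → ℝ} :
    x ∈ dilationHull Ω ↔ ∃ a : RStar d, dilation a.1 a.2 x ∈ Ω := by
  rw [mem_dilationHull]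
  constructor
  · rintro ⟨a, ha, w, hw, rfl⟩
    refine ⟨⟨a⁻¹, inv_mem ha⟩, ?_⟩
    change a * w * a⁻¹ ∈ Ω
    rwa [mul_comm, inv_mul_cancel_of_mem ha]
  · rintro ⟨a, hx⟩
    exact ⟨a.1⁻¹, inv_mem a.2, _, hx, (mul_comm _ _).trans ((dilation a.1 a.2).left_inv x)⟩

theorem exists_apply_mul_eq_mul_of_tsupport_subset {a : Fin d → ℝ} (ha : a ∈ RStar d)
    {χ : (Fin d → ℝ) → 𝕜} (hχ : ContDiff ℝ ∞ χ) (hχΩ : tsupport χ ⊆ dilation a ha ⁻¹' Ω)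
    (K : Compacts (Fin d → ℝ)) :
    ∃ P : 𝓓_{K}(Fin d → ℝ, 𝕜) →L[𝕜] 𝓓(Ω, 𝕜), ∀ f x, P f (x * a) = f x * χ x := by
  let K₁ : Compacts (Fin d → ℝ) :=
    ⟨K ∩ tsupport χ, K.isCompact.inter_right (isClosed_tsupport χ)⟩
  let K₂ : Compacts (Fin d → ℝ) := K₁.map (dilation a ha) (dilation a ha).continuous
  have hK₂ : (K₂ : Set (Fin d → ℝ)) ⊆ Ω := image_subset_iff.2 fun x hx => hχΩ hx.2
  let g : (Fin d → ℝ) →L[ℝ] (Fin d → ℝ) := (ContinuousLinearMap.mul ℝ _).flip a⁻¹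
  have hg : g ⁻¹' K₁ ⊆ K₂ := ((dilation a ha).image_eq_preimage_symm _).ge
  refine ⟨TestFunction.ofSupportedInCLM 𝕜 hK₂ ∘L compLinearCLM 𝕜 g hg ∘L
    mulSmoothCLM hχ Subset.rfl, fun f x => ?_⟩
  exact congrArg (fun z => f z * χ z) ((dilation a ha).left_inv x)

theorem exists_decomposition (K : Compacts (Fin d → ℝ))
    (hK : (K : Set (Fin d → ℝ)) ⊆ dilationHull Ω) :
    ∃ (t : Finset (RStar d)) (P : RStar d → 𝓓_{K}(Fin d → ℝ, 𝕜) →L[𝕜] 𝓓(Ω, 𝕜)),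
      ∀ f x, f x = ∑ a ∈ t, P a f (x * a.1) := by
  obtain ⟨t, χ, hχ, hχΩ, hsum⟩ := exists_contDiff_finsetSum_eq_one K.isCompact
    (fun a : RStar d => Ω.isOpen.preimage (dilation a.1 a.2).continuous)
    fun x hx => mem_iUnion.2 (mem_dilationHull_iff_exists_dilation_mem.1 (hK hx))
  have hχ𝕜 (a : RStar d) : ContDiff ℝ ∞ fun x => (χ a x : 𝕜) :=
    (RCLike.ofRealCLM (K := 𝕜)).contDiff.comp (hχ a)
  have hχ𝕜Ω (a : RStar d) : tsupport (fun x => (χ a x : 𝕜)) ⊆ dilation a.1 a.2 ⁻¹' Ω :=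
    (tsupport_comp_subset RCLike.ofReal_zero (χ a)).trans (hχΩ a)
  choose P hP using fun a : RStar d =>
    exists_apply_mul_eq_mul_of_tsupport_subset a.2 (hχ𝕜 a) (hχ𝕜Ω a) K
  refine ⟨t, P, fun f x => ?_⟩
  simp_rw [hP, ← Finset.mul_sum, ← RCLike.ofReal_sum]
  by_cases hx : x ∈ K
  · rw [hsum x hx, RCLike.ofReal_one, mul_one]
  · rw [f.zero_on_compl hx, Pi.zero_apply, zero_mul]

end Localization

section Kernel

variable {𝕜 : Type*} [RCLike 𝕜] {d : ℕ} {Ω : Opens (Fin d → ℝ)}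

theorem hasMoments_of_forall_apply_eq {L : DPrime 𝕜 Ω →L[𝕜] DPrime 𝕜 Ω} {M : 𝓓(Ω, 𝕜) → 𝓓(Ω, 𝕜)}
    (hM : ∀ S φ, L S φ = S (M φ)) {m : (Fin d → ℕ) → 𝕜}
    (hm : ∀ α, L (monomial 𝕜 Ω α) = m α • monomial 𝕜 Ω α) (φ : 𝓓(Ω, 𝕜)) :
    HasMoments m φ (M φ) := fun α => by
  rw [← monomial_apply, ← monomial_apply, ← hM, hm]
  rfl

theorem HasMoments.testFunction_unique {Ω₁ Ω₂ : Opens (Fin d → ℝ)} {m : (Fin d → ℕ) → 𝕜}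
    {φ : (Fin d → ℝ) → 𝕜} {ψ₁ : 𝓓(Ω₁, 𝕜)} {ψ₂ : 𝓓(Ω₂, 𝕜)} (h₁ : HasMoments m φ ψ₁)
    (h₂ : HasMoments m φ ψ₂) (x : Fin d → ℝ) : ψ₁ x = ψ₂ x :=
  congrFun (h₁.unique h₂ ψ₁.continuous ψ₂.continuous ψ₁.hasCompactSupport ψ₂.hasCompactSupport) x

theorem finsetSum_testFunction_apply {κ : Type*} (s : Finset κ) (ψ : κ → 𝓓(Ω, 𝕜)) (x : Fin d → ℝ) :
    (∑ i ∈ s, ψ i) x = ∑ i ∈ s, ψ i x :=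
  map_sum (dirac 𝕜 Ω x) ψ s

theorem hasMoments_sum_dilate {m : (Fin d → ℕ) → 𝕜} {t : Finset (RStar d)}
    {φ ψ : RStar d → 𝓓(Ω, 𝕜)} (h : ∀ a ∈ t, HasMoments m (φ a) (ψ a)) {f : (Fin d → ℝ) → 𝕜}
    (hf : ∀ x, f x = ∑ a ∈ t, φ a (x * a.1)) :
    HasMoments m f (∑ a ∈ t, dilate (incl (ψ a)) a.1 a.2 : 𝓓(dilationHull Ω, 𝕜)) := by
  have hφ : f = fun x => ∑ a ∈ t, dilate (incl (φ a)) a.1 a.2 x := funext hf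
  rw [hφ, funext (finsetSum_testFunction_apply t _)]
  exact HasMoments.sum t (fun a ha => (h a ha).comp_mul_right a.2)
    (fun _ _ => TestFunction.continuous _) (fun _ _ => TestFunction.hasCompactSupport _)
    (fun _ _ => TestFunction.continuous _) (fun _ _ => TestFunction.hasCompactSupport _)

theorem exists_hasMoments_of_dilationHull {M : 𝓓(Ω, 𝕜) → 𝓓(Ω, 𝕜)} {m : (Fin d → ℕ) → 𝕜}
    (hm : ∀ φ : 𝓓(Ω, 𝕜), HasMoments m φ (M φ)) (φ : 𝓓(dilationHull Ω, 𝕜)) :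
    ∃ ψ : 𝓓(dilationHull Ω, 𝕜), HasMoments m φ ψ := by
  obtain ⟨t, P, hP⟩ := exists_decomposition (𝕜 := 𝕜)
    ⟨tsupport φ, φ.hasCompactSupport⟩ φ.tsupport_subset
  exact ⟨_, hasMoments_sum_dilate (fun a _ => hm (P a _)) (hP (toSupportedIn φ))⟩

theorem exists_forall_apply_eq_apply_one {L : DPrime 𝕜 Ω →L[𝕜] DPrime 𝕜 Ω}
    {M : 𝓓(Ω, 𝕜) → 𝓓(Ω, 𝕜)} (hM : ∀ S φ, L S φ = S (M φ)) {m : (Fin d → ℕ) → 𝕜}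
    (hm : ∀ φ : 𝓓(Ω, 𝕜), HasMoments m φ (M φ)) {N : 𝓓(dilationHull Ω, 𝕜) → 𝓓(dilationHull Ω, 𝕜)}
    (hN : ∀ φ : 𝓓(dilationHull Ω, 𝕜), HasMoments m φ (N φ)) :
    ∃ T : DPrime 𝕜 (dilationHull Ω), ∀ φ, T φ = N φ 1 := by
  choose t P hP using exists_decomposition (𝕜 := 𝕜) (Ω := Ω)
  refine ⟨TestFunction.limitCLM 𝕜 (fun φ => N φ 1)
    (fun K hK => ∑ a ∈ t K hK, L (dirac 𝕜 Ω a.1) ∘L P K hK a) fun K hK f => ?_, fun _ => rfl⟩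
  calc N (TestFunction.ofSupportedIn hK f) 1
      = (∑ a ∈ t K hK, dilate (incl (M (P K hK a f))) a.1 a.2 : 𝓓(dilationHull Ω, 𝕜)) 1 :=
        (hN _).testFunction_unique
          (hasMoments_sum_dilate (fun a _ => hm (P K hK a f)) (hP K hK f)) 1
    _ = ∑ a ∈ t K hK, M (P K hK a f) (1 * a.1) := finsetSum_testFunction_apply _ _ 1
    _ = (∑ a ∈ t K hK, L (dirac 𝕜 Ω a.1) ∘L P K hK a) f := by
        simp only [one_mul, sum_apply, ContinuousLinearMap.comp_apply, hM, dirac_apply]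

theorem isTransform_of_forall_apply_eq_apply_one {m : (Fin d → ℕ) → 𝕜}
    {N : 𝓓(dilationHull Ω, 𝕜) → 𝓓(dilationHull Ω, 𝕜)}
    (hN : ∀ φ : 𝓓(dilationHull Ω, 𝕜), HasMoments m φ (N φ)) {T : DPrime 𝕜 (dilationHull Ω)}
    (hT : ∀ φ, T φ = N φ 1) (φ : 𝓓(dilationHull Ω, 𝕜)) : IsTransform T φ (N φ) := fun y hy => by
  have hdilate : HasMoments m (dilate φ y hy) (dilate (N φ) y hy) := (hN φ).comp_mul_right hy
  calc N φ y = N φ (1 * y) := by rw [one_mul]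
    _ = N (dilate φ y hy) 1 := hdilate.testFunction_unique (hN _) 1
    _ = T (dilate φ y hy) := (hT _).symm

theorem exists_isTransform {L : DPrime 𝕜 Ω →L[𝕜] DPrime 𝕜 Ω} {M : 𝓓(Ω, 𝕜) → 𝓓(Ω, 𝕜)}
    (hM : ∀ S φ, L S φ = S (M φ)) {m : (Fin d → ℕ) → 𝕜}
    (hm : ∀ α, L (monomial 𝕜 Ω α) = m α • monomial 𝕜 Ω α) :
    ∃ T : DPrime 𝕜 (dilationHull Ω),
      (∀ φ, ∃ ψ : 𝓓(dilationHull Ω, 𝕜), IsTransform T φ ψ) ∧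
        ∀ φ : 𝓓(Ω, 𝕜), IsTransform T (incl φ) (M φ) := by
  have hMm := hasMoments_of_forall_apply_eq hM hm
  choose N hN using exists_hasMoments_of_dilationHull hMm
  obtain ⟨T, hT⟩ := exists_forall_apply_eq_apply_one hM hMm hN
  have hTN := isTransform_of_forall_apply_eq_apply_one hN hT
  exact ⟨T, fun φ => ⟨N φ, hTN φ⟩, fun φ y hy =>
    ((hMm φ).testFunction_unique (hN (incl φ)) y).trans (hTN (incl φ) y hy)⟩

end Kernel

section Support

variable {𝕜 : Type*} [RCLike 𝕜] {d : ℕ} {Ω : Opens (Fin d → ℝ)} {T : DPrime 𝕜 (dilationHull Ω)}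

theorem notMem_supp_of_isVanishingOn {U : Opens (Fin d → ℝ)} {T : DPrime 𝕜 U}
    {s : Set (Fin d → ℝ)} (h : Distribution.IsVanishingOn T s) {x : Fin d → ℝ} (hx : s ∈ 𝓝 x) :
    x ∉ supp T := fun hxT =>
  ((h.mono interior_subset).disjoint_dsupport isOpen_interior).le_bot
    ⟨mem_interior_iff_mem_nhds.2 hx, hxT.1⟩

theorem isVanishingOn_of_isTransform {M : 𝓓(Ω, 𝕜) → 𝓓(Ω, 𝕜)}
    (hT : ∀ φ : 𝓓(Ω, 𝕜), IsTransform T (incl φ) (M φ)) {K K' : Set (Fin d → ℝ)} (hKΩ : K ⊆ Ω)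
    (hKK' : ∀ φ : 𝓓(Ω, 𝕜), tsupport φ ⊆ K → tsupport (M φ) ⊆ K') {y : Fin d → ℝ}
    (hy : y ∈ RStar d) (hyK' : y ∉ K') :
    Distribution.IsVanishingOn T ((· * y) ⁻¹' K) := by
  intro u hu
  let v := dilate u y⁻¹ (inv_mem hy)
  have hvK : tsupport v ⊆ K := fun x hx => by
    have hxu : x * y⁻¹ ∈ tsupport u :=
      tsupport_comp_subset_preimage u (dilation y⁻¹ (inv_mem hy)).continuous hx
    have hxK : x * y⁻¹ * y ∈ K := hu hxu
    rwa [show x * y⁻¹ * y = x from (dilation y hy).right_inv x] at hxK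
  let φ : 𝓓(Ω, 𝕜) := ⟨v, v.contDiff, v.hasCompactSupport, hvK.trans hKΩ⟩
  have hφ : dilate (incl φ) y hy = u := by
    ext x
    exact congrArg u ((dilation y hy).left_inv x)
  rw [← hφ, ← hT φ y hy]
  exact image_eq_zero_of_notMem_tsupport fun h => hyK' (hKK' φ hvK h)

theorem exists_compact_forall_isVanishingOn {L : DPrime 𝕜 Ω →L[𝕜] DPrime 𝕜 Ω}
    {M : 𝓓(Ω, 𝕜) →ₗ[𝕜] 𝓓(Ω, 𝕜)} (hM : ∀ S φ, L S φ = S (M φ))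
    (hT : ∀ φ : 𝓓(Ω, 𝕜), IsTransform T (incl φ) (M φ)) (K : Compacts (Fin d → ℝ))
    (hK : (K : Set (Fin d → ℝ)) ⊆ Ω) :
    ∃ K' : Compacts (Fin d → ℝ), (K' : Set (Fin d → ℝ)) ⊆ Ω ∧
      ∀ y ∈ RStar d, y ∉ K' → Distribution.IsVanishingOn T ((· * y) ⁻¹' K) := by
  obtain ⟨K', hK', hMK'⟩ :=
    exists_compact_forall_tsupport_transpose_subset hM (TestFunction.ofSupportedInCLM 𝕜 hK)
  refine ⟨K', hK', fun y hy hyK' => isVanishingOn_of_isTransform hT hK (fun φ hφ => ?_) hy hyK'⟩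
  exact hMK' (.of_support_subset φ.contDiff ((subset_tsupport φ).trans hφ))

theorem dense_rStar (d : ℕ) : Dense (RStar d) := by
  have h := dense_pi univ (s := fun _ : Fin d => ({0}ᶜ : Set ℝ))
    fun _ _ => dense_compl_singleton 0
  rwa [show univ.pi (fun _ : Fin d => ({0}ᶜ : Set ℝ)) = RStar d by ext; simp [RStar]] at h

theorem exists_mem_rStar_mul_mul_eq_notMem {a w : Fin d → ℝ} (ha : a ∈ RStar d) {j : Fin d}
    (hwj : w j = 0) {B : Set (Fin d → ℝ)} (hB : IsBounded B) :
    ∃ y ∈ RStar d, a * w * y = w ∧ y ∉ B := by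
  obtain ⟨R, hR0, hR⟩ := hB.exists_pos_norm_le
  refine ⟨Function.update a⁻¹ j (R + 1), fun i => ?_, funext fun i => ?_, fun hy => ?_⟩
  · rcases eq_or_ne i j with rfl | hi
    · simpa using (by positivity : R + 1 ≠ 0)
    · simpa [hi] using ha i
  · rcases eq_or_ne i j with rfl | hi
    · simp [hwj]
    · simp [hi, mul_comm (a i), ha i]
  · have hj := (le_abs_self _).trans ((norm_le_pi_norm _ j).trans (hR _ hy))
    rw [Function.update_self] at hj
    linarith

theorem supp_subset_rStar
    (h : ∀ K : Compacts (Fin d → ℝ), (K : Set (Fin d → ℝ)) ⊆ Ω →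
      ∃ K' : Compacts (Fin d → ℝ),
        ∀ y ∈ RStar d, y ∉ K' → Distribution.IsVanishingOn T ((· * y) ⁻¹' K)) :
    supp T ⊆ RStar d := by
  intro x hxT j hj
  obtain ⟨a, ha, w, hw, rfl⟩ := mem_dilationHull.1 hxT.2
  obtain ⟨K, hK, hwK, hKΩ⟩ := exists_compact_subset Ω.isOpen hw
  obtain ⟨K', hK'⟩ := h ⟨K, hK⟩ hKΩ
  have hwj : w j = 0 := (mul_eq_zero.1 hj).resolve_left (ha j)
  obtain ⟨y, hy, hawy, hyK'⟩ := exists_mem_rStar_mul_mul_eq_notMem ha hwj K'.isCompact.isBounded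
  refine notMem_supp_of_isVanishingOn (hK' y hy hyK') ?_ hxT
  refine (continuous_mul_const y).continuousAt.preimage_mem_nhds ?_
  rw [hawy]
  exact mem_interior_iff_mem_nhds.1 hwK

theorem inv_supp_mul_subset (hT : supp T ⊆ RStar d) {C K K' : Set (Fin d → ℝ)}
    (hCK : C ⊆ interior K) (hK' : IsClosed K')
    (h : ∀ y ∈ RStar d, y ∉ K' → Distribution.IsVanishingOn T ((· * y) ⁻¹' K)) :
    (supp T)⁻¹ * C ⊆ K' := by
  rintro _ ⟨s, hs, k, hk, rfl⟩
  by_contra hsk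
  have hsR : s ∈ RStar d := by simpa using inv_mem (hT hs)
  have hopen : IsOpen (interior K ∩ (s * ·) ⁻¹' K'ᶜ) :=
    isOpen_interior.inter (hK'.isOpen_compl.preimage (continuous_const_mul s))
  obtain ⟨z, ⟨hzK, hzK'⟩, hzR⟩ := (dense_rStar d).inter_open_nonempty _ hopen ⟨k, hCK hk, hsk⟩
  refine notMem_supp_of_isVanishingOn (h (s * z) (mul_mem hsR hzR) hzK') ?_ hs
  refine (continuous_mul_const (s * z)).continuousAt.preimage_mem_nhds ?_
  rw [inv_mul_cancel_of_mem hsR]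
  exact mem_interior_iff_mem_nhds.1 hzK

end Support

end HadamardOp

theorem theorem3p8 {𝕜 : Type*} [RCLike 𝕜] {d : ℕ} (Ω : Opens (Fin d → ℝ))
    (L : HadamardOp.DPrime 𝕜 Ω →L[𝕜] HadamardOp.DPrime 𝕜 Ω) (hL : HadamardOp.IsHadamard L) :
    ∃ T : HadamardOp.DPrime 𝕜 (HadamardOp.dilationHull Ω),
      HadamardOp.MemDH T ∧
        ∀ S : HadamardOp.DPrime 𝕜 Ω, HadamardOp.IsMulConvolution S T (L S) := by
  open HadamardOp in
  obtain ⟨M, hM⟩ := exists_linearMap_forall_apply_eq L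
  choose m hm using hL
  obtain ⟨T, hmaps, hTM⟩ := exists_isTransform hM hm
  have hvanish := exists_compact_forall_isVanishingOn hM hTM
  have hsupp : supp T ⊆ RStar d :=
    supp_subset_rStar fun K hK => (hvanish K hK).imp fun _ h => h.2
  refine ⟨T, ⟨hmaps, hsupp, fun C hC hCΩ => ?_⟩, fun S φ => ⟨M φ, hTM φ, hM S φ⟩⟩
  obtain ⟨K, hK, hCK, hKΩ⟩ := exists_compact_between hC Ω.isOpen hCΩ
  obtain ⟨K', hK'Ω, hK'⟩ := hvanish ⟨K, hK⟩ hKΩ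
  exact ⟨K', K'.isCompact, hK'Ω, inv_supp_mul_subset hsupp hCK K'.isCompact.isClosed hK'⟩
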